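/- Call a category $\mathcal K$ finitely concrete if there exists a faithful functor $U:\mathcal K\to\mathbf{Set}$ that preserves directed colimits, i.e. colimits of diagrams indexed by (small, non-empty) directed partially ordered sets. Theorem: the category $\mathbf{CC^*Alg}$, whose objects are the commutative unital (complex) $C^*$-algebras and whose morphisms are the unit-preserving $*$-homomorphisms, is not finitely concrete. -/

import Mathlib

open CategoryTheory CategoryTheory.Limits

universe w v₁ v₂ u₁ u₂ u

/-- A functor preserves (small) directed colimits if it preserves colimits of all diagrams indexed
by a (small) nonempty directed poset. The universe `w` is the universe of the index posets. -/
def PreservesDirectedColimits {C : Type u₁} [Category.{v₁} C] {D : Type u₂} [Category.{v₂} D]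
    (F : C ⥤ D) : Prop :=
  ∀ (J : Type w) [PartialOrder J] [IsDirectedOrder J] [Nonempty J], PreservesColimitsOfShape J F

/-- A category (with `v₁`-small hom-sets) is finitely concrete if it admits a faithful functor into
the category of (`v₁`-small) sets which preserves (`v₁`-small) directed colimits. -/
def FinitelyConcrete (C : Type u₁) [Category.{v₁} C] : Prop :=
  ∃ U : C ⥤ Type v₁, U.Faithful ∧ PreservesDirectedColimits.{v₁} U

/-- The category of commutative unital (complex) C⋆-algebras. -/
structure CommCStarAlgCat : Type (u + 1) where
  /-- The underlying type. -/
  carrier : Type u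
  [commCStarAlgebra : CommCStarAlgebra carrier]

namespace CommCStarAlgCat

attribute [instance] commCStarAlgebra

instance : CoeSort CommCStarAlgCat.{u} (Type u) := ⟨carrier⟩

/-- Morphisms of commutative unital C⋆-algebras: the unital `ℂ`-algebra homomorphisms preserving
the involution. -/
@[ext]
structure Hom (A B : CommCStarAlgCat.{u}) where
  /-- The underlying unital star-homomorphism. -/
  hom' : A →⋆ₐ[ℂ] B

instance : Category CommCStarAlgCat.{u} where
  Hom A B := Hom A B
  id A := ⟨StarAlgHom.id ℂ A⟩
  comp f g := ⟨g.hom'.comp f.hom'⟩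

instance : ConcreteCategory CommCStarAlgCat.{u} (fun A B => A →⋆ₐ[ℂ] B) where
  hom := Hom.hom'
  ofHom := Hom.mk

end CommCStarAlgCat

/-! For `x` in a compact Hausdorff space `X`, the scalars are the directed colimit of the algebras
`C(K, ℂ)` over closed neighbourhoods `K` of `x`: near `x` a function is within `ε` of its value
there, and homomorphisms are contractive, so every cocone sees only that value. If `U` preserves
this colimit, an element `a` of `U C(X)` and its constant version at `x` already agree over some
`K`, so `x ↦ U(eval x) a` is locally constant. On the interval it is constant; faithfulness then
equates evaluation at 0 and 1, which `eval_injective` excludes. -/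

namespace CommCStarAlgCat

open scoped Topology
open TopologicalSpace

/-- The commutative C⋆-algebra of continuous complex functions on a compact space. -/
noncomputable abbrev ofCompact (X : Type u) [TopologicalSpace X] [CompactSpace X] :
    CommCStarAlgCat.{u} :=
  ⟨C(X, ℂ)⟩

/-- Precomposition with a continuous map of compact spaces. -/
noncomputable def pullback {X Y : Type u} [TopologicalSpace X] [CompactSpace X]
    [TopologicalSpace Y] [CompactSpace Y] (f : C(X, Y)) : ofCompact Y ⟶ ofCompact X :=
  ⟨ContinuousMap.compStarAlgHom' ℂ ℂ f⟩

/-- Evaluation at a point, with values in the continuous functions on the one-point space. -/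
noncomputable abbrev eval {X : Type u} [TopologicalSpace X] [CompactSpace X] (x : X) :
    ofCompact X ⟶ ofCompact PUnit.{u + 1} :=
  pullback (ContinuousMap.const _ x)

theorem norm_hom_sub_algebraMap_le {X : Type u} [TopologicalSpace X] [CompactSpace X]
    {A : CommCStarAlgCat.{u}} (φ : ofCompact X ⟶ A) (g : C(X, ℂ)) (z : ℂ) {ε : ℝ} (hε : 0 ≤ ε)
    (h : ∀ y, ‖g y - z‖ ≤ ε) : ‖φ.hom' g - algebraMap ℂ A z‖ ≤ ε := by
  rw [← AlgHomClass.commutes φ.hom' z, ← map_sub]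
  exact (NonUnitalStarAlgHom.norm_apply_le φ.hom' _).trans ((ContinuousMap.norm_le _ hε).mpr h)

/-- The unital inclusion of the scalars, seen as the functions on the one-point space, into the
functions on `X`. -/
noncomputable abbrev scalars (X : Type u) [TopologicalSpace X] [CompactSpace X] :
    ofCompact PUnit.{u + 1} ⟶ ofCompact X :=
  pullback (ContinuousMap.const _ PUnit.unit)

variable {X : Type u} [TopologicalSpace X]

/-- The closed neighbourhoods of a point, ordered by reverse inclusion. -/
abbrev ClosedNhds (x : X) : Type u :=
  {K : Closeds X // (K : Set X) ∈ 𝓝 x}ᵒᵈ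

namespace ClosedNhds

variable {x : X}

/-- The underlying closed set of a closed neighbourhood. -/
abbrev toCloseds (K : ClosedNhds x) : Closeds X :=
  (OrderDual.ofDual K).1

theorem mem_nhds (K : ClosedNhds x) : (K.toCloseds : Set X) ∈ 𝓝 x :=
  (OrderDual.ofDual K).2

theorem self_mem (K : ClosedNhds x) : x ∈ K.toCloseds :=
  mem_of_mem_nhds K.mem_nhds

instance : Nonempty (ClosedNhds x) :=
  ⟨OrderDual.toDual ⟨⊤, Filter.univ_mem⟩⟩

instance : IsDirectedOrder (ClosedNhds x) :=
  ⟨fun K L => ⟨OrderDual.toDual ⟨K.toCloseds ⊓ L.toCloseds,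
    Filter.inter_mem K.mem_nhds L.mem_nhds⟩, fun _ h => h.1, fun _ h => h.2⟩⟩

instance [CompactSpace X] (K : ClosedNhds x) : CompactSpace K.toCloseds :=
  isCompact_iff_compactSpace.mp K.toCloseds.isClosed.isCompact

/-- The inclusion of a smaller closed neighbourhood into a larger one. -/
def inclusion {K L : ClosedNhds x} (h : K ≤ L) : C(L.toCloseds, K.toCloseds) :=
  ⟨Set.inclusion h, continuous_inclusion h⟩

/-- The inclusion of a closed neighbourhood into the whole space. -/
def incl (K : ClosedNhds x) : C(K.toCloseds, X) :=
  ⟨Subtype.val, continuous_subtype_val⟩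

variable [CompactSpace X]

/-- The directed diagram of function algebras on the closed neighbourhoods of a point. -/
noncomputable def diagram (x : X) : ClosedNhds x ⥤ CommCStarAlgCat.{u} where
  obj K := ofCompact K.toCloseds
  map f := pullback (inclusion (leOfHom f))
  map_id _ := rfl
  map_comp _ _ := rfl

/-- Evaluation at `x` on function algebras of closed neighbourhoods of `x`. -/
noncomputable def cocone (x : X) : Cocone (diagram x) where
  pt := ofCompact PUnit.{u + 1}
  ι :=
    { app := fun K => eval (⟨x, K.self_mem⟩ : K.toCloseds)
      naturality := fun _ _ _ => rfl }

/-- Any cocone over the diagram of function algebras on the closed neighbourhoods of `x`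
sends a function to its value at `x`, since homomorphisms are contractive. -/
theorem cocone_apply_eq_algebraMap [T2Space X] (s : Cocone (diagram x)) (K : ClosedNhds x)
    (g : C(K.toCloseds, ℂ)) :
    (s.ι.app K).hom' g = algebraMap ℂ s.pt (g ⟨x, K.self_mem⟩) := by
  rw [← sub_eq_zero, ← norm_le_zero_iff]
  refine le_of_forall_pos_le_add fun ε hε => ?_
  rw [zero_add]
  set z : ℂ := g ⟨x, K.self_mem⟩ with hz
  have hU : (Subtype.val '' {y : K.toCloseds | dist (g y) z < ε}) ∈ 𝓝 x := by
    have h : {y : K.toCloseds | dist (g y) z < ε} ∈ 𝓝 (⟨x, K.self_mem⟩ : K.toCloseds) :=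
      g.continuous.continuousAt.eventually (Metric.ball_mem_nhds _ hε)
    rw [← map_nhds_subtype_coe_eq_nhds (p := (· ∈ K.toCloseds)) K.self_mem K.mem_nhds]
    exact Filter.image_mem_map h
  -- Regularity of `X` gives a closed neighbourhood on which `g` is `ε`-close to `z`.
  obtain ⟨t, ht, htc, hts⟩ := exists_mem_nhds_isClosed_subset hU
  let L : ClosedNhds x := OrderDual.toDual ⟨⟨t, htc⟩, ht⟩
  have hKL : K ≤ L := fun y hy => by
    obtain ⟨w, -, rfl⟩ := hts hy
    exact w.2
  have hnat : (s.ι.app K).hom' g = (s.ι.app L).hom' (g.comp (inclusion hKL)) :=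
    congrArg (fun m : (diagram x).obj K ⟶ s.pt => m.hom' g) (s.w (homOfLE hKL)).symm
  rw [hnat]
  refine norm_hom_sub_algebraMap_le (s.ι.app L) (g.comp (inclusion hKL)) z hε.le fun y => ?_
  obtain ⟨w, hw, hwy⟩ := hts y.2
  obtain rfl : w = inclusion hKL y := Subtype.ext hwy
  exact (dist_eq_norm (g (inclusion hKL y)) z).symm.trans_le (le_of_lt hw)

/-- The algebra of functions on a point is the colimit of the algebras of functions on its closed
neighbourhoods. -/
noncomputable def isColimitCocone [T2Space X] (x : X) : IsColimit (cocone x) where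
  desc s := scalars _ ≫ s.ι.app (OrderDual.toDual ⟨⊤, Filter.univ_mem⟩)
  fac s K := by
    refine Hom.ext (StarAlgHom.ext fun g => ?_)
    exact (cocone_apply_eq_algebraMap s _ _).trans (cocone_apply_eq_algebraMap s K g).symm
  uniq s m hm := by
    -- A constant evaluated at `x` is itself, so `scalars` is a section of the top leg.
    rw [← hm]
    rfl

end ClosedNhds

/-- If `U` preserves directed colimits, then every element of `U C(X)` defines a locally constant
function on `X` by evaluation at points. -/
theorem isLocallyConstant_map_eval [CompactSpace X] [T2Space X] {U : CommCStarAlgCat.{u} ⥤ Type u}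
    (hU : PreservesDirectedColimits.{u} U) (a : U.obj (ofCompact X)) :
    IsLocallyConstant fun x : X => U.map (eval x) a := by
  rw [IsLocallyConstant.iff_eventually_eq]
  intro x
  have := hU (ClosedNhds x)
  let T : ClosedNhds x := OrderDual.toDual ⟨⊤, Filter.univ_mem⟩
  have ht := isColimitOfPreserves U (ClosedNhds.isColimitCocone x)
  have hcomp {A B C : CommCStarAlgCat.{u}} (f : A ⟶ B) (g : B ⟶ C) (b : U.obj A) :
      U.map g (U.map f b) = U.map (f ≫ g) b := by
    rw [U.map_comp]
    rfl
  -- Both elements, `a` and its value at `x` spread out as a constant, have the same image in the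
  -- colimit, so they agree at a stage `K`.
  obtain ⟨K, f, h⟩ := (Types.FilteredColimit.isColimit_eq_iff' ht (i := T)
    (U.map (pullback T.incl) a) (U.map (eval x ≫ scalars _) a)).mp
      ((hcomp (pullback T.incl) (eval _) a).trans (hcomp (eval x ≫ scalars _) (eval _) a).symm)
  filter_upwards [K.mem_nhds] with y hy
  let r : ofCompact T.toCloseds ⟶ ofCompact PUnit.{u + 1} :=
    (ClosedNhds.diagram x).map f ≫ eval (⟨y, hy⟩ : K.toCloseds)
  have hr (b : U.obj (ofCompact T.toCloseds)) :
      U.map (eval (⟨y, hy⟩ : K.toCloseds)) (U.map ((ClosedNhds.diagram x).map f) b) = U.map r b :=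
    hcomp _ _ b
  -- Evaluation at `y ∈ K` factors through restriction to `K`, where `a` may be replaced by the
  -- constant.
  calc U.map (eval y) a = U.map r (U.map (pullback T.incl) a) := (hcomp (pullback T.incl) r a).symm
    _ = U.map r (U.map (eval x ≫ scalars _) a) :=
      (hr _).symm.trans ((congrArg (U.map (eval (⟨y, hy⟩ : K.toCloseds))) h).trans (hr _))
    _ = U.map (eval x) a := hcomp (eval x ≫ scalars _) r a

/-- Urysohn's lemma supplies a function separating the two points. -/
theorem eval_injective [CompactSpace X] [T2Space X] :
    Function.Injective (eval : X → (ofCompact X ⟶ ofCompact PUnit.{u + 1})) := by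
  intro x y hxy
  by_contra hne
  obtain ⟨f, hfx, hfy, -⟩ := exists_continuous_zero_one_of_isClosed (isClosed_singleton (x := x))
    (isClosed_singleton (x := y)) (Set.disjoint_singleton.mpr hne)
  let g : C(X, ℂ) := ⟨fun z => (f z : ℂ), by fun_prop⟩
  have h : g x = g y :=
    congrArg (fun m : ofCompact X ⟶ ofCompact PUnit.{u + 1} => (m.hom' g) PUnit.unit) hxy
  have h0 : f x = 0 := hfx rfl
  have h1 : f y = 1 := hfy rfl
  simp [g, h0, h1] at h

end CommCStarAlgCat

open CommCStarAlgCat in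
theorem theorem3p2 : ¬ FinitelyConcrete CommCStarAlgCat.{u} := by
  rintro ⟨U, hF, hU⟩
  let X := ULift.{u} unitInterval
  have : PreconnectedSpace X :=
    Homeomorph.ulift.symm.surjective.denseRange.preconnectedSpace Homeomorph.ulift.symm.continuous
  have h : (eval (⟨0⟩ : X)) = eval ⟨1⟩ := U.map_injective (by
    ext a
    exact (isLocallyConstant_map_eval hU a).apply_eq_of_preconnectedSpace _ _)
  exact zero_ne_one (congrArg ULift.down (eval_injective h))
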